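/- Let $\mathbb{F}_q$ be a finite field with $q>3$ elements, $A=\mathbb{F}_q[t]$ and $\Gamma=SL_2(A)$. For an ideal $\mathfrak{q}$ of $A$ put $\Gamma(\mathfrak{q})=\{M\in\Gamma : M\equiv I_2 \bmod \mathfrak{q}\}$. A subgroup of $\Gamma$ is a congruence subgroup if it contains $\Gamma(\mathfrak{q})$ for some ideal $\mathfrak{q}\neq\{0\}$; a non-congruence subgroup is a subgroup of finite index that is not a congruence subgroup. A subgroup $S\le\Gamma$ of finite index is a genuine non-congruence subgroup if $\Psi(S)$ is a non-congruence subgroup for every group automorphism $\Psi\in\mathrm{Aut}(\Gamma)$. Let $\mathrm{nncs}(\Gamma)$ be the smallest index in $\Gamma$ of a normal non-congruence subgroup, and $\mathrm{ngncs}(\Gamma)$ the smallest index in $\Gamma$ of a normal genuine non-congruence subgroup. **Theorem.** If $N$ is a normal genuine non-congruence subgroup of $\Gamma$, then $|\Gamma:N|$ is divisible by $q\cdot|PSL_2(\mathbb{F}_q)|$. Moreover, normal non-congruence subgroups and normal genuine non-congruence subgroups of $\Gamma$ exist, and $$\mathrm{ngncs}(\Gamma)>\mathrm{nncs}(\Gamma)=|PSL_2(\mathbb{F}_q)|.$$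 -/

import Mathlib

namespace DrinfeldSL2

open Matrix

/-- The principal congruence subgroup `Γ(I) = {M ∈ SL₂(A) : M ≡ 1 mod I}` of an ideal `I`. -/
def principalCongruenceSubgroup (A : Type*) [CommRing A] (I : Ideal A) :
    Subgroup (SpecialLinearGroup (Fin 2) A) :=
  (SpecialLinearGroup.map (n := Fin 2) (Ideal.Quotient.mk I)).ker

theorem mem_principalCongruenceSubgroup {A : Type*} [CommRing A] (I : Ideal A)
    (M : SpecialLinearGroup (Fin 2) A) :
    M ∈ principalCongruenceSubgroup A I ↔
      ∀ i j, (M : Matrix (Fin 2) (Fin 2) A) i j - (1 : Matrix (Fin 2) (Fin 2) A) i j ∈ I := by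
  rw [principalCongruenceSubgroup, MonoidHom.mem_ker]
  refine (Matrix.SpecialLinearGroup.ext_iff _ _).trans ?_
  refine forall_congr' fun i => forall_congr' fun j => ?_
  rw [← Ideal.Quotient.mk_eq_mk_iff_sub_mem]
  have h : Ideal.Quotient.mk I ((1 : Matrix (Fin 2) (Fin 2) A) i j) =
      (1 : Matrix (Fin 2) (Fin 2) (A ⧸ I)) i j := by
    by_cases hij : i = j <;> simp [Matrix.one_apply, hij]
  rw [h]
  rfl

/-- A congruence subgroup of `SL₂(A)` contains `Γ(I)` for some nonzero ideal `I`. -/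
def IsCongruence {A : Type*} [CommRing A] (S : Subgroup (SpecialLinearGroup (Fin 2) A)) : Prop :=
  ∃ I : Ideal A, I ≠ ⊥ ∧ principalCongruenceSubgroup A I ≤ S

/-- A non-congruence subgroup is a finite index subgroup that is not a congruence subgroup. -/
def IsNonCongruence {A : Type*} [CommRing A]
    (S : Subgroup (SpecialLinearGroup (Fin 2) A)) : Prop :=
  S.FiniteIndex ∧ ¬ IsCongruence S

/-- A finite index subgroup of `SL₂(A)` is a genuine non-congruence subgroup if its image under
every group automorphism of `SL₂(A)` is a non-congruence subgroup. -/
def IsGenuineNonCongruence {A : Type*} [CommRing A]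
    (S : Subgroup (SpecialLinearGroup (Fin 2) A)) : Prop :=
  S.FiniteIndex ∧
    ∀ Ψ : MulAut (SpecialLinearGroup (Fin 2) A), IsNonCongruence (S.map Ψ.toMonoidHom)

/-- The indices of the normal non-congruence subgroups of `SL₂(A)`. -/
def normalNonCongruenceIndices (A : Type*) [CommRing A] : Set ℕ :=
  {n | ∃ S : Subgroup (SpecialLinearGroup (Fin 2) A),
    S.Normal ∧ IsNonCongruence S ∧ S.index = n}

/-- The indices of the normal genuine non-congruence subgroups of `SL₂(A)`. -/
def normalGenuineNonCongruenceIndices (A : Type*) [CommRing A] : Set ℕ :=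
  {n | ∃ S : Subgroup (SpecialLinearGroup (Fin 2) A),
    S.Normal ∧ IsGenuineNonCongruence S ∧ S.index = n}

/-- `nncs(SL₂(A))`: the smallest index of a normal non-congruence subgroup
(`0` if there is none). -/
noncomputable def nncs (A : Type*) [CommRing A] : ℕ :=
  sInf (normalNonCongruenceIndices A)

/-- `ngncs(SL₂(A))`: the smallest index of a normal genuine non-congruence subgroup
(`0` if there is none). -/
noncomputable def ngncs (A : Type*) [CommRing A] : ℕ :=
  sInf (normalGenuineNonCongruenceIndices A)

end DrinfeldSL2

/-! A functional `φ : K[X] → K` with `φ 1 = 1` that is merely `K`-linear already induces a homomorphism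
`SL₂(K[X]) → SL₂(K)`, because `SL₂(K[X])` is the amalgam of `SL₂(K)` and the upper triangular
matrices along their intersection (`linearLift`; the universal property is obtained by running the
Euclidean algorithm on the first column). The kernel `projKer φ` of the resulting surjection onto
`PSL₂(K)` is a normal subgroup of index `|PSL₂(K)|`.

A proper normal subgroup `N` meets the constant matrices `SL₂(K)` in scalars only, since `SL₂(K)` is
quasi-simple and its normal closure is everything. So `|PSL₂(K)|` divides the index of `N`. The
polynomials `f` with `upper f ∈ N` form a proper subspace of `K[X]` (`quasiLevel`). If its
codimension is at least two, then `q²` divides the index, and as `q` is the exact `p`-part of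
`|PSL₂(K)|`, so does `q |PSL₂(K)|`. If it is a hyperplane, a linear automorphism of `K[X]` fixing `1`
moves it to the ideal `(X)`; the automorphism of `SL₂(K[X])` that this induces (`linearAut`) maps `N`
to a subgroup containing `Γ((X))`, so `N` is not genuine
(`dvd_index_of_isGenuineNonCongruence`). In particular a normal subgroup of index exactly
`|PSL₂(K)|` is some `projKer φ` (`exists_eq_projKer`).

Such a `projKer φ` is a congruence subgroup only if `φ` is the evaluation at a point of `K`
(`eq_eval_of_le_projKer`): looking at the matrices `!![0, u; -u⁻¹, 0]` modulo `I`, one finds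
`φ u * φ u⁻¹ = 1` for all units `u` of `K[X] ⧸ I`, and in a finite algebra this forces a functional
to be multiplicative (`map_mul_of_map_inv`). Any other `φ` gives a normal non-congruence subgroup of
the minimal index. Automorphisms permute the subgroups `projKer φ`, and only `q` of these are
congruence subgroups, so the intersection of any `q + 1` of them is a genuine non-congruence
subgroup (`isGenuineNonCongruence_iInf`). -/

namespace DrinfeldSL2

open Matrix Polynomial
open scoped MatrixGroups commutatorElement

/-! ### Generators of `SL₂` over a Euclidean domain -/

section Generators

variable {R S : Type*} [CommRing R] [CommRing S]

/-- The upper unipotent matrix with off-diagonal entry `x`. -/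
def upper (x : R) : SL(2, R) := ⟨!![1, x; 0, 1], by simp⟩

/-- The Weyl element. -/
def weyl : SL(2, R) := ⟨!![0, 1; -1, 0], by simp⟩

/-- The diagonal matrix with entries `u` and `u⁻¹`. -/
def torus (u : Rˣ) : SL(2, R) := ⟨!![(u : R), 0; 0, ((u⁻¹ : Rˣ) : R)], by simp⟩

@[simp] theorem coe_upper (x : R) : (upper x : Matrix (Fin 2) (Fin 2) R) = !![1, x; 0, 1] := rfl

@[simp] theorem coe_weyl : ((weyl : SL(2, R)) : Matrix (Fin 2) (Fin 2) R) = !![0, 1; -1, 0] := rfl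

@[simp] theorem coe_torus (u : Rˣ) :
    (torus u : Matrix (Fin 2) (Fin 2) R) = !![(u : R), 0; 0, ((u⁻¹ : Rˣ) : R)] := rfl

@[simp] theorem coe_weyl_inv :
    ((weyl⁻¹ : SL(2, R)) : Matrix (Fin 2) (Fin 2) R) = !![0, -1; 1, 0] := by
  simp [adjugate_fin_two]

theorem literal_mul_zero (a b c d : R) (N : Matrix (Fin 2) (Fin 2) R) (j : Fin 2) :
    (!![a, b; c, d] * N) 0 j = a * N 0 j + b * N 1 j := by
  simp [Matrix.mul_apply, Fin.sum_univ_two, -Matrix.cons_mul]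

theorem literal_mul_one (a b c d : R) (N : Matrix (Fin 2) (Fin 2) R) (j : Fin 2) :
    (!![a, b; c, d] * N) 1 j = c * N 0 j + d * N 1 j := by
  simp [Matrix.mul_apply, Fin.sum_univ_two, -Matrix.cons_mul]

theorem ext_rows {M N : SL(2, R)} (h0 : ∀ j, M 0 j = N 0 j) (h1 : ∀ j, M 1 j = N 1 j) : M = N :=
  Matrix.SpecialLinearGroup.ext _ _ fun i => by
    fin_cases i
    exacts [h0, h1]

theorem upper_mul_zero (x : R) (M : SL(2, R)) (j : Fin 2) :
    (upper x * M) 0 j = M 0 j + x * M 1 j := by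
  change ((upper x : Matrix (Fin 2) (Fin 2) R) * (M : Matrix (Fin 2) (Fin 2) R)) _ j = _
  rw [coe_upper, literal_mul_zero, one_mul]

theorem upper_mul_one (x : R) (M : SL(2, R)) (j : Fin 2) : (upper x * M) 1 j = M 1 j := by
  change ((upper x : Matrix (Fin 2) (Fin 2) R) * (M : Matrix (Fin 2) (Fin 2) R)) _ j = _
  rw [coe_upper, literal_mul_one, one_mul, zero_mul, zero_add]

theorem weyl_mul_zero (M : SL(2, R)) (j : Fin 2) : (weyl * M : SL(2, R)) 0 j = M 1 j := by
  change (((weyl : SL(2, R)) : Matrix (Fin 2) (Fin 2) R) * (M : Matrix (Fin 2) (Fin 2) R)) _ j = _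
  rw [coe_weyl, literal_mul_zero, one_mul, zero_mul, zero_add]

theorem weyl_mul_one (M : SL(2, R)) (j : Fin 2) : (weyl * M : SL(2, R)) 1 j = -M 0 j := by
  change (((weyl : SL(2, R)) : Matrix (Fin 2) (Fin 2) R) * (M : Matrix (Fin 2) (Fin 2) R)) _ j = _
  rw [coe_weyl, literal_mul_one, neg_one_mul, zero_mul, add_zero]

theorem weyl_inv_mul_zero (M : SL(2, R)) (j : Fin 2) : (weyl⁻¹ * M : SL(2, R)) 0 j = -M 1 j := by
  change (((weyl⁻¹ : SL(2, R)) : Matrix (Fin 2) (Fin 2) R) * (M : Matrix (Fin 2) (Fin 2) R)) _ j = _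
  rw [coe_weyl_inv, literal_mul_zero, neg_one_mul, zero_mul, zero_add]

theorem weyl_inv_mul_one (M : SL(2, R)) (j : Fin 2) : (weyl⁻¹ * M : SL(2, R)) 1 j = M 0 j := by
  change (((weyl⁻¹ : SL(2, R)) : Matrix (Fin 2) (Fin 2) R) * (M : Matrix (Fin 2) (Fin 2) R)) _ j = _
  rw [coe_weyl_inv, literal_mul_one, one_mul, zero_mul, add_zero]

theorem torus_mul_zero (u : Rˣ) (M : SL(2, R)) (j : Fin 2) :
    (torus u * M) 0 j = u * M 0 j := by
  change ((torus u : Matrix (Fin 2) (Fin 2) R) * (M : Matrix (Fin 2) (Fin 2) R)) _ j = _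
  rw [coe_torus, literal_mul_zero, zero_mul, add_zero]

theorem torus_mul_one (u : Rˣ) (M : SL(2, R)) (j : Fin 2) :
    (torus u * M) 1 j = ((u⁻¹ : Rˣ) : R) * M 1 j := by
  change ((torus u : Matrix (Fin 2) (Fin 2) R) * (M : Matrix (Fin 2) (Fin 2) R)) _ j = _
  rw [coe_torus, literal_mul_one, zero_mul, zero_add]

theorem upper_add (x y : R) : upper (x + y) = upper x * upper y := by
  apply Subtype.ext
  simp [add_comm]

@[simp] theorem upper_zero : upper (0 : R) = 1 := by
  apply Subtype.ext
  simp [one_fin_two]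

theorem upper_neg (x : R) : upper (-x) = (upper x)⁻¹ :=
  eq_inv_of_mul_eq_one_left (by rw [← upper_add]; simp)

theorem torus_mul_upper (u : Rˣ) (x : R) :
    torus u * upper x * (torus u)⁻¹ = upper ((u : R) ^ 2 * x) := by
  rw [mul_inv_eq_iff_eq_mul]
  apply Subtype.ext
  simp [pow_two, mul_right_comm]

theorem torus_eq (u : Rˣ) :
    torus u = upper (u : R) * (weyl * upper ((u⁻¹ : Rˣ) : R) * weyl⁻¹) * upper (u : R) * weyl⁻¹ := by
  apply Subtype.ext
  simp

theorem map_upper (f : R →+* S) (x : R) :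
    SpecialLinearGroup.map f (upper x) = upper (f x) := by
  ext i j
  fin_cases i <;> fin_cases j <;> simp

theorem map_weyl (f : R →+* S) : SpecialLinearGroup.map f (weyl : SL(2, R)) = weyl := by
  ext i j
  fin_cases i <;> fin_cases j <;> simp

theorem eq_torus_mul_upper {M : SL(2, R)} (h : M 1 0 = 0) :
    ∃ (u : Rˣ) (x : R), M = torus u * upper x := by
  have hdet : M 0 0 * M 1 1 = 1 := by
    have := M.det_coe
    rw [det_fin_two, h] at this
    simpa using this
  refine ⟨⟨M 0 0, M 1 1, hdet, by rw [mul_comm, hdet]⟩, M 1 1 * M 0 1, ?_⟩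
  ext i j
  fin_cases i <;> fin_cases j <;> simp [h, ← mul_assoc, hdet]

theorem torus_mem {H : Subgroup SL(2, R)} (hu : ∀ x, upper x ∈ H) (hw : weyl ∈ H) (u : Rˣ) :
    torus u ∈ H := by
  rw [torus_eq]
  exact H.mul_mem (H.mul_mem (H.mul_mem (hu _) (H.mul_mem (H.mul_mem hw (hu _)) (H.inv_mem hw)))
    (hu _)) (H.inv_mem hw)

/-- Over a Euclidean domain the Euclidean algorithm on the first column shows that the upper
unipotent matrices and the Weyl element generate `SL₂`. -/
theorem eq_top_of_upper_of_weyl {E : Type*} [EuclideanDomain E] {H : Subgroup SL(2, E)}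
    (hu : ∀ x, upper x ∈ H) (hw : weyl ∈ H) : H = ⊤ := by
  suffices h : ∀ (c : E) (M : SL(2, E)), M 1 0 = c → M ∈ H from
    eq_top_iff.mpr fun M _ => h _ M rfl
  intro c
  induction c using (EuclideanDomain.r_wellFounded (R := E)).induction with
  | _ c ih =>
  intro M hM
  by_cases hc : c = 0
  · obtain ⟨u, x, rfl⟩ := eq_torus_mul_upper (hM.trans hc)
    exact H.mul_mem (torus_mem hu hw u) (hu x)
  · have key : weyl⁻¹ * upper (-(M 0 0 / c)) * M ∈ H := by
      refine ih (M 0 0 % c) (EuclideanDomain.mod_lt _ hc) _ ?_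
      rw [EuclideanDomain.mod_eq_sub_mul_div]
      rw [mul_assoc, weyl_inv_mul_one, upper_mul_zero, hM]
      ring
    exact (H.mul_mem_cancel_left (H.mul_mem (H.inv_mem hw) (hu _))).mp key

theorem hom_ext_of_upper_of_weyl {E G : Type*} [EuclideanDomain E] [Group G] {f g : SL(2, E) →* G}
    (hu : ∀ x, f (upper x) = g (upper x)) (hw : f weyl = g weyl) : f = g := by
  have h : f.eqLocus g = ⊤ := eq_top_of_upper_of_weyl (H := f.eqLocus g) hu hw
  ext M
  exact (h ▸ Subgroup.mem_top M : M ∈ f.eqLocus g)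

end Generators

/-! ### The universal property of `SL₂(K[X])` -/

section Lift

variable {K R : Type*} [Field K] [CommRing R] [Algebra K R]

/-- One step of the Euclidean algorithm on the first column: the matrix whose product with
`upper s * weyl` on the left is `M`, where `s` is the quotient of the entries of that column. -/
noncomputable def euclidStep (M : SL(2, K[X])) : SL(2, K[X]) :=
  weyl⁻¹ * (upper (-(M 0 0 / M 1 0)) * M)

theorem euclidStep_zero_zero (M : SL(2, K[X])) : euclidStep M 0 0 = -M 1 0 := by
  rw [euclidStep, weyl_inv_mul_zero, upper_mul_one]

theorem euclidStep_one_zero (M : SL(2, K[X])) : euclidStep M 1 0 = M 0 0 % M 1 0 := by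
  rw [euclidStep, weyl_inv_mul_one, upper_mul_zero, EuclideanDomain.mod_eq_sub_mul_div]
  ring

theorem euclidStep_eq (M : SL(2, K[X])) {s : K[X]} (hs : M 0 0 / M 1 0 = s) :
    upper s * (weyl * euclidStep M) = M := by
  rw [euclidStep, hs, upper_neg]
  group

theorem degree_euclidStep_lt {M : SL(2, K[X])} (h : M 1 0 ≠ 0) :
    (euclidStep M 1 0).degree < (M 1 0).degree := by
  rw [euclidStep_one_zero]
  exact EuclideanDomain.mod_lt _ h

open Classical in
/-- The map underlying `linearLift`. A matrix with lower-left entry `0` is mapped entrywise by `φ`;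
otherwise one step of the Euclidean algorithm is split off on the left. -/
noncomputable def liftAux (φ : K[X] →ₗ[K] R) (M : SL(2, K[X])) : Matrix (Fin 2) (Fin 2) R :=
  if h : M 1 0 = 0 then (M : Matrix (Fin 2) (Fin 2) K[X]).map φ
  else !![1, φ (M 0 0 / M 1 0); 0, 1] * (!![0, 1; -1, 0] * liftAux φ (euclidStep M))
termination_by (M 1 0).degree
decreasing_by exact degree_euclidStep_lt h

variable {φ : K[X] →ₗ[K] R} (h1 : φ 1 = 1)

theorem liftAux_of_eq_zero {M : SL(2, K[X])} (h : M 1 0 = 0) :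
    liftAux φ M = (M : Matrix (Fin 2) (Fin 2) K[X]).map φ := by
  unfold liftAux
  exact dif_pos h

theorem liftAux_of_ne_zero {M : SL(2, K[X])} (h : M 1 0 ≠ 0) :
    liftAux φ M = !![1, φ (M 0 0 / M 1 0); 0, 1] * (!![0, 1; -1, 0] * liftAux φ (euclidStep M)) := by
  conv_lhs => unfold liftAux
  exact dif_neg h

/-- The units of `K[X]` are constants, so an upper triangular matrix in `SL₂(K[X])` has a constant
diagonal. This is where entrywise application of a merely linear `φ` is multiplicative. -/
theorem exists_eq_C_of_lower_zero {M : SL(2, K[X])} (h : M 1 0 = 0) :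
    ∃ a d : K, a * d = 1 ∧ M 0 0 = C a ∧ M 1 1 = C d := by
  obtain ⟨u, x, rfl⟩ := eq_torus_mul_upper h
  obtain ⟨a, ha, hu⟩ := Polynomial.isUnit_iff.mp u.isUnit
  obtain ⟨d, hd, hv⟩ := Polynomial.isUnit_iff.mp u⁻¹.isUnit
  refine ⟨a, d, ?_, by simp [hu], by simp [hv]⟩
  apply C_injective
  rw [C_mul, hu, hv]
  simp

theorem map_C_mul (φ : K[X] →ₗ[K] R) (a : K) (f : K[X]) : φ (C a * f) = algebraMap K R a * φ f := by
  rw [← smul_eq_C_mul, map_smul, Algebra.smul_def]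

include h1 in
theorem map_C (a : K) : φ (C a) = algebraMap K R a := by
  simpa [h1] using map_C_mul φ a 1

theorem div_eq_of_eq_mul_add {f g q r : K[X]} (h : f = q * g + r) (hr : r.degree < g.degree) :
    f / g = q := by
  have hg : g ≠ 0 := fun h0 => by simp [h0] at hr
  have hmod : (f % g).degree < g.degree := EuclideanDomain.mod_lt _ hg
  have heq : (f / g - q) * g = r - f % g := by
    linear_combination h + EuclideanDomain.mod_add_div' f g
  by_contra hne
  have h1 : g.degree ≤ ((f / g - q) * g).degree := by
    rw [mul_comm]
    exact degree_le_mul_left _ (sub_ne_zero.mpr hne)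
  rw [heq] at h1
  exact absurd (h1.trans (degree_sub_le _ _)) (not_le.mpr (max_lt hr hmod))

theorem literal_upper_add (x y : R) :
    (!![1, x + y; 0, 1] : Matrix (Fin 2) (Fin 2) R) = !![1, x; 0, 1] * !![1, y; 0, 1] := by
  simp [add_comm]

include h1 in
theorem liftAux_upper_mul (f : K[X]) (M : SL(2, K[X])) :
    liftAux φ (upper f * M) = !![1, φ f; 0, 1] * liftAux φ M := by
  have h10 : (upper f * M) 1 0 = M 1 0 := upper_mul_one f M 0
  by_cases h : M 1 0 = 0
  · obtain ⟨a, d, -, ha, hd⟩ := exists_eq_C_of_lower_zero h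
    rw [liftAux_of_eq_zero h, liftAux_of_eq_zero (h10.trans h)]
    ext i j
    fin_cases i <;> fin_cases j <;>
      simp only [Fin.zero_eta, Fin.mk_one, Matrix.map_apply, upper_mul_zero, upper_mul_one,
        literal_mul_zero, literal_mul_one, h, hd, map_add, map_zero, mul_zero, one_mul, zero_mul,
        zero_add, add_zero, mul_comm f, map_C_mul, map_C h1, mul_comm (φ f)]
  · have hdiv : (upper f * M) 0 0 / (upper f * M) 1 0 = f + M 0 0 / M 1 0 := by
      rw [h10, upper_mul_zero]
      refine div_eq_of_eq_mul_add (r := M 0 0 % M 1 0) ?_ (EuclideanDomain.mod_lt _ h)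
      linear_combination -(EuclideanDomain.mod_add_div' (M 0 0) (M 1 0))
    have hstep : euclidStep (upper f * M) = euclidStep M := by
      simp only [euclidStep, hdiv, neg_add_rev, upper_add, upper_neg f, mul_assoc,
        inv_mul_cancel_left]
    rw [liftAux_of_ne_zero h, liftAux_of_ne_zero (h10 ▸ h), hdiv, hstep, map_add,
      literal_upper_add, mul_assoc]

theorem torus_C_apply (a : Kˣ) (M : SL(2, K[X])) :
    (∀ j, (torus (Units.map C.toMonoidHom a) * M) 0 j = C (a : K) * M 0 j) ∧
      ∀ j, (torus (Units.map C.toMonoidHom a) * M) 1 j = C ((a : K)⁻¹) * M 1 j := by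
  refine ⟨fun j => torus_mul_zero _ M j, fun j => (torus_mul_one _ M j).trans ?_⟩
  simp

theorem C_mul_C_inv {a : K} (ha : a ≠ 0) : C a * C a⁻¹ = 1 := by
  rw [← C_mul, mul_inv_cancel₀ ha, C_1]

theorem liftAux_torus_mul (a : Kˣ) (M : SL(2, K[X])) :
    liftAux φ (torus (Units.map C.toMonoidHom a) * M) =
      !![algebraMap K R a, 0; 0, algebraMap K R (a : K)⁻¹] * liftAux φ M := by
  induction hn : (M 1 0).degree using WellFoundedLT.induction generalizing a M with
  | _ n ih =>
  obtain ⟨t0, t1⟩ := torus_C_apply a M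
  by_cases h : M 1 0 = 0
  · rw [liftAux_of_eq_zero h, liftAux_of_eq_zero (by rw [t1, h, mul_zero])]
    ext i j
    fin_cases i <;> fin_cases j <;>
      simp only [Fin.zero_eta, Fin.mk_one, Matrix.map_apply, t0, t1,
        literal_mul_zero, literal_mul_one, zero_mul,
        zero_add, add_zero, map_C_mul]
  · have hC := C_mul_C_inv a.ne_zero
    have h' : (torus (Units.map C.toMonoidHom a) * M) 1 0 ≠ 0 := by
      rw [t1]
      exact mul_ne_zero (by simp) h
    have hquot : C (a : K) * M 0 0 / (C (a : K)⁻¹ * M 1 0) = C (a : K) ^ 2 * (M 0 0 / M 1 0) := by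
      refine div_eq_of_eq_mul_add (r := C (a : K) * (M 0 0 % M 1 0)) ?_ ?_
      · linear_combination (-C (a : K)) * (EuclideanDomain.mod_add_div' (M 0 0) (M 1 0)) -
          C (a : K) * (M 0 0 / M 1 0) * M 1 0 * hC
      · rw [degree_C_mul a.ne_zero, degree_C_mul (inv_ne_zero a.ne_zero)]
        exact EuclideanDomain.mod_lt _ h
    have hdiv : (torus (Units.map C.toMonoidHom a) * M) 0 0 /
        (torus (Units.map C.toMonoidHom a) * M) 1 0 = C (a : K) ^ 2 * (M 0 0 / M 1 0) := by
      rw [t0, t1, hquot]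
    have hstep : euclidStep (torus (Units.map C.toMonoidHom a) * M) =
        torus (Units.map C.toMonoidHom a⁻¹) * euclidStep M := by
      obtain ⟨e0, e1⟩ := torus_C_apply a⁻¹ (euclidStep M)
      refine ext_rows (fun j => ?_) (fun j => ?_)
      · rw [e0, Units.val_inv_eq_inv_val]
        simp only [euclidStep, weyl_inv_mul_zero, upper_mul_one, t1, mul_neg]
      · rw [e1, Units.val_inv_eq_inv_val, inv_inv]
        simp only [euclidStep, hquot, weyl_inv_mul_one, upper_mul_zero, t0, t1]
        linear_combination (-C (a : K) * (M 0 0 / M 1 0) * M 1 j) * hC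
    have hR : algebraMap K R (a : K) * algebraMap K R (a : K)⁻¹ = 1 := by
      rw [← map_mul, mul_inv_cancel₀ a.ne_zero, map_one]
    rw [liftAux_of_ne_zero h, liftAux_of_ne_zero h', hdiv, hstep,
      ih _ (hn ▸ degree_euclidStep_lt h) _ _ rfl, ← C_pow, map_C_mul, map_pow,
      Units.val_inv_eq_inv_val, inv_inv]
    ext i j
    fin_cases i <;> simp only [Fin.zero_eta, Fin.mk_one, literal_mul_zero, literal_mul_one]
    · linear_combination (-(algebraMap K R (a : K)) * φ (M 0 0 / M 1 0) *
        liftAux φ (euclidStep M) 0 j) * hR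
    · ring

theorem liftAux_of_zero_div {M : SL(2, K[X])} (h : M 1 0 ≠ 0) (h' : M 0 0 / M 1 0 = 0) :
    liftAux φ M = !![0, 1; -1, 0] * liftAux φ (weyl⁻¹ * M) := by
  rw [liftAux_of_ne_zero h, euclidStep, h']
  simp [← one_fin_two]

theorem weyl_inv_mul (M : SL(2, K[X])) :
    weyl⁻¹ * M = torus (Units.map C.toMonoidHom (-1 : Kˣ)) * (weyl * M) := by
  obtain ⟨e0, e1⟩ := torus_C_apply (-1 : Kˣ) (weyl * M)
  refine ext_rows (fun j => ?_) (fun j => ?_)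
  · simp only [e0, weyl_inv_mul_zero, weyl_mul_zero]
    simp
  · simp only [e1, weyl_inv_mul_one, weyl_mul_one]
    simp

/-- The Bruhat decomposition of the lower unipotent matrices over the constants. -/
theorem weyl_mul_upper_mul_weyl_mul (k : Kˣ) (M : SL(2, K[X])) :
    weyl * (upper (C (k : K)) * (weyl * M)) = upper (-C (k : K)⁻¹) *
      (torus (Units.map C.toMonoidHom (-k⁻¹)) * (weyl * (upper (-C (k : K)⁻¹) * M))) := by
  obtain ⟨e0, e1⟩ := torus_C_apply (-k⁻¹) (weyl * (upper (-C (k : K)⁻¹) * M))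
  have hC := C_mul_C_inv k.ne_zero
  have hv : (((-k⁻¹ : Kˣ) : K))⁻¹ = -(k : K) := by
      rw [Units.val_neg, Units.val_inv_eq_inv_val, inv_neg, inv_inv]
  rw [hv] at e1
  refine ext_rows (fun j => ?_) (fun j => ?_)
  · simp only [e0, e1, weyl_mul_zero, weyl_mul_one, upper_mul_zero,
      upper_mul_one, Units.val_neg, Units.val_inv_eq_inv_val, C_neg]
    linear_combination (M 0 j - C (k : K)⁻¹ * M 1 j) * hC
  · simp only [e1, weyl_mul_zero, weyl_mul_one, upper_mul_zero,
      upper_mul_one, C_neg]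
    linear_combination (M 1 j) * hC

include h1 in
theorem liftAux_weyl_mul (M : SL(2, K[X])) :
    liftAux φ (weyl * M) = !![0, 1; -1, 0] * liftAux φ M := by
  -- if the upper-left entry has the larger degree, the Euclidean step for `weyl * M` is `weyl`
  have hgt : ∀ M : SL(2, K[X]), (M 1 0).degree < (M 0 0).degree →
      liftAux φ (weyl * M) = !![0, 1; -1, 0] * liftAux φ M := by
    intro M hM
    have ha : -M 0 0 ≠ 0 := fun h => by simp [neg_eq_zero.mp h] at hM
    have := liftAux_of_zero_div (φ := φ) (M := weyl * M) (by rwa [weyl_mul_one])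
      (by rwa [weyl_mul_one, weyl_mul_zero, Polynomial.div_eq_zero_iff ha, degree_neg])
    rw [this, inv_mul_cancel_left]
  rcases lt_trichotomy (M 1 0).degree (M 0 0).degree with hlt | heq | hlt
  · exact hgt M hlt
  -- equal degrees: the quotient is a nonzero constant `k`, and the Bruhat decomposition of
  -- `weyl * upper k * weyl` leaves a matrix to which `hgt` applies
  · have hc : M 1 0 ≠ 0 := by
      intro h
      have h0 : M 0 0 = 0 := by rwa [h, degree_zero, eq_comm, degree_eq_bot] at heq
      have hdet := M.det_coe
      rw [det_fin_two, h, h0] at hdet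
      simp at hdet
    obtain ⟨k, hk⟩ : ∃ k : Kˣ, M 0 0 / M 1 0 = C (k : K) := by
      have hdeg := degree_add_div hc heq.le
      have h0 : (M 0 0 / M 1 0).degree = 0 := by
        rw [← heq, degree_eq_natDegree hc] at hdeg
        have hq : M 0 0 / M 1 0 ≠ 0 := fun h => by simp [h] at hdeg
        rw [degree_eq_natDegree hq] at hdeg ⊢
        norm_cast at hdeg ⊢
        omega
      obtain ⟨a, ha, hu⟩ := Polynomial.isUnit_iff.mp (isUnit_iff_degree_eq_zero.mpr h0)
      exact ⟨ha.unit, hu.symm⟩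
    have hlt : ((upper (-C (k : K)⁻¹) * euclidStep M) 1 0).degree <
        ((upper (-C (k : K)⁻¹) * euclidStep M) 0 0).degree := by
      have hmod := degree_euclidStep_lt hc
      have hs : (-C (k : K)⁻¹ * euclidStep M 1 0).degree = (euclidStep M 1 0).degree := by
        rw [neg_mul, degree_neg, degree_C_mul (inv_ne_zero k.ne_zero)]
      rw [upper_mul_zero, upper_mul_one, euclidStep_zero_zero,
        degree_add_eq_left_of_degree_lt (by rwa [hs, degree_neg]), degree_neg]
      exact hmod
    have hR : algebraMap K R (k : K) * algebraMap K R (k : K)⁻¹ = 1 := by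
      rw [← map_mul, mul_inv_cancel₀ k.ne_zero, map_one]
    have hv : (((-k⁻¹ : Kˣ) : K))⁻¹ = -(k : K) := by
      rw [Units.val_neg, Units.val_inv_eq_inv_val, inv_neg, inv_inv]
    conv_lhs => rw [← euclidStep_eq M hk, weyl_mul_upper_mul_weyl_mul, liftAux_upper_mul h1,
      liftAux_torus_mul, hgt _ hlt, liftAux_upper_mul h1]
    rw [liftAux_of_ne_zero hc, hk, hv, map_neg, map_C h1, map_C h1, Units.val_neg,
      Units.val_inv_eq_inv_val, map_neg, map_neg]
    ext i j
    fin_cases i <;> simp only [Fin.zero_eta, Fin.mk_one, literal_mul_zero, literal_mul_one]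
    · linear_combination (-liftAux φ (euclidStep M) 0 j + algebraMap K R (k : K)⁻¹ *
        liftAux φ (euclidStep M) 1 j) * hR
    · linear_combination (-liftAux φ (euclidStep M) 1 j) * hR
  · have hc : M 1 0 ≠ 0 := fun h => by simp [h] at hlt
    rw [liftAux_of_zero_div hc ((Polynomial.div_eq_zero_iff hc).mpr hlt), weyl_inv_mul,
      liftAux_torus_mul]
    ext i j
    fin_cases i <;> simp only [Fin.zero_eta, Fin.mk_one, literal_mul_zero, literal_mul_one] <;>
      simp

theorem liftAux_one : liftAux φ 1 = !![φ 1, 0; 0, φ 1] := by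
  rw [liftAux_of_eq_zero (by simp)]
  ext i j
  fin_cases i <;> fin_cases j <;> simp

include h1 in
theorem liftAux_mul (M N : SL(2, K[X])) : liftAux φ (M * N) = liftAux φ M * liftAux φ N := by
  have hone : liftAux φ (1 : SL(2, K[X])) = 1 := by rw [liftAux_one, h1, one_fin_two]
  let H : Subgroup SL(2, K[X]) :=
    { carrier := {M | ∀ N, liftAux φ (M * N) = liftAux φ M * liftAux φ N}
      one_mem' := fun N => by rw [hone, one_mul, one_mul]
      mul_mem' := fun {M M'} hM hM' N => by rw [mul_assoc, hM, hM', hM, mul_assoc]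
      inv_mem' := fun {M} hM N => by
        have h : liftAux φ M⁻¹ * liftAux φ M = 1 := by
          rw [mul_eq_one_comm, ← hM, mul_inv_cancel, hone]
        rw [← mul_inv_cancel_left M N, hM, ← mul_assoc (liftAux φ M⁻¹), h, one_mul,
          mul_inv_cancel_left] }
  have hH : H = ⊤ := eq_top_of_upper_of_weyl
    (fun f N => by
      have h := liftAux_upper_mul h1 f 1
      rw [mul_one, hone, mul_one] at h
      rw [liftAux_upper_mul h1, h])
    (fun N => by
      have h := liftAux_weyl_mul h1 1
      rw [mul_one, hone, mul_one] at h
      rw [liftAux_weyl_mul h1, h])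
  exact (hH ▸ Subgroup.mem_top M : M ∈ H) N

theorem liftAux_upper (f : K[X]) : liftAux φ (upper f) = !![φ 1, φ f; 0, φ 1] := by
  rw [liftAux_of_eq_zero (by simp)]
  ext i j
  fin_cases i <;> fin_cases j <;> simp

include h1 in
theorem liftAux_weyl : liftAux φ weyl = !![0, 1; -1, 0] := by
  have h := liftAux_weyl_mul h1 1
  rwa [mul_one, liftAux_one, h1, ← one_fin_two, mul_one] at h

/-- **Universal property of `SL₂(K[X])`** (Nagao). A `K`-linear map `φ : K[X] → R` with `φ 1 = 1`
induces a group homomorphism `SL₂(K[X]) → SL₂(R)`, which is `upper f ↦ upper (φ f)` on the upper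
unipotent matrices and the identity on matrices with constant entries. -/
noncomputable def linearLift (φ : K[X] →ₗ[K] R) (h1 : φ 1 = 1) : SL(2, K[X]) →* SL(2, R) where
  toFun M := ⟨liftAux φ M, by
    let f : SL(2, K[X]) →* Matrix (Fin 2) (Fin 2) R :=
      { toFun := liftAux φ
        map_one' := by rw [liftAux_one, h1, one_fin_two]
        map_mul' := liftAux_mul h1 }
    have h : ((Matrix.detMonoidHom.comp f).toHomUnits) = 1 := by
      refine hom_ext_of_upper_of_weyl (fun x => Units.ext ?_) (Units.ext ?_)
      · change (liftAux φ (upper x)).det = 1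
        rw [liftAux_upper, h1]
        simp
      · change (liftAux φ weyl).det = 1
        rw [liftAux_weyl h1]
        simp
    exact congrArg Units.val (DFunLike.congr_fun h M)⟩
  map_one' := Subtype.ext (by
    change liftAux φ 1 = 1
    rw [liftAux_one, h1, one_fin_two])
  map_mul' M N := Subtype.ext (liftAux_mul h1 M N)

@[simp] theorem linearLift_upper (f : K[X]) : linearLift φ h1 (upper f) = upper (φ f) :=
  Subtype.ext ((liftAux_upper f).trans (by rw [h1, coe_upper]))

@[simp] theorem linearLift_weyl : linearLift φ h1 weyl = weyl :=
  Subtype.ext (liftAux_weyl h1)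

end Lift

/-! ### Finite fields and `SL₂` over a finite field -/

theorem exists_ne_of_three_lt_card {K : Type*} (hK : 3 < Nat.card K) (x y z : K) :
    ∃ a : K, a ≠ x ∧ a ≠ y ∧ a ≠ z := by
  classical
  by_contra! h
  have hsub : (Set.univ : Set K) ⊆ (({x, y, z} : Finset K) : Set K) := fun a _ => by
    have := h a
    simp only [Finset.coe_insert, Finset.coe_singleton, Set.mem_insert_iff, Set.mem_singleton_iff]
    tauto
  have hle := Set.ncard_le_ncard hsub (Finset.finite_toSet _)
  rw [Set.ncard_univ, Set.ncard_coe_finset] at hle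
  exact absurd (hle.trans Finset.card_le_three) (not_le.mpr hK)

section FiniteField

variable {K : Type*} [Field K]

theorem exists_unit_sq_ne_one (hK : 3 < Nat.card K) : ∃ a : Kˣ, (a : K) ^ 2 ≠ 1 := by
  obtain ⟨a, h0, h1, h2⟩ := exists_ne_of_three_lt_card hK 0 1 (-1)
  exact ⟨Units.mk0 a h0, fun h => (mul_self_eq_one_iff.mp ((pow_two a).symm.trans h)).elim h1 h2⟩

/-- A polynomial of degree at most two vanishing on all nonzero elements of a field with more than
three elements has leading coefficient zero. -/
theorem eq_zero_of_forall_quadratic (hK : 3 < Nat.card K) {α β γ : K}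
    (h : ∀ a : K, a ≠ 0 → α * a ^ 2 + β * a + γ = 0) : α = 0 := by
  obtain ⟨a, ha0, ha1, -⟩ := exists_ne_of_three_lt_card hK 0 1 0
  obtain ⟨b, hb0, hb1, hba⟩ := exists_ne_of_three_lt_card hK 0 1 a
  have e1 := h 1 one_ne_zero
  have ea := h a ha0
  have eb := h b hb0
  have fa : α * (a + 1) + β = 0 := by
    refine (mul_eq_zero.mp ?_).resolve_left (sub_ne_zero.mpr ha1)
    linear_combination ea - e1
  have fb : α * (b + 1) + β = 0 := by
    refine (mul_eq_zero.mp ?_).resolve_left (sub_ne_zero.mpr hb1)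
    linear_combination eb - e1
  refine (mul_eq_zero.mp ?_).resolve_right (sub_ne_zero.mpr hba)
  linear_combination fb - fa

theorem exists_eq_sq_sub_sq [Finite K] (k : K) : ∃ a b : K, k = a ^ 2 - b ^ 2 := by
  by_cases h2 : ringChar K = 2
  · obtain ⟨a, ha⟩ := FiniteField.isSquare_of_char_two h2 k
    exact ⟨a, 0, by rw [ha]; ring⟩
  · have h2' : (2 : K) ≠ 0 := Ring.two_ne_zero h2
    refine ⟨(k + 1) / 2, (k - 1) / 2, ?_⟩
    field_simp
    ring

theorem upper_mem_center_iff {R : Type*} [CommRing R] {x : R} :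
    upper x ∈ Subgroup.center SL(2, R) ↔ x = 0 := by
  refine ⟨fun h => ?_, fun h => by rw [h, upper_zero]; exact one_mem _⟩
  obtain ⟨r, -, hr⟩ := Matrix.SpecialLinearGroup.mem_center_iff.mp h
  simpa using (congrFun (congrFun hr 0) 1).symm

/-- `SL₂(K)` is quasi-simple: being perfect with simple central quotient `PSL₂(K)`, its only
noncentral normal subgroup is the whole group. -/
theorem le_center_or_eq_top (hK : 3 < Nat.card K) (H : Subgroup SL(2, K)) [H.Normal] :
    H ≤ Subgroup.center SL(2, K) ∨ H = ⊤ := by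
  obtain ⟨a, ha⟩ := exists_unit_sq_ne_one hK
  have hsimple : IsSimpleGroup PSL(2, K) := Matrix.ProjectiveSpecialLinearGroup.rank_two_simple hK
  let π := QuotientGroup.mk' (Subgroup.center SL(2, K))
  have hn : (H.map π).Normal := Subgroup.Normal.map inferInstance _ (QuotientGroup.mk'_surjective _)
  refine hn.eq_bot_or_eq_top.imp (fun h => ?_) (fun h => ?_)
  · rw [Subgroup.map_eq_bot_iff, QuotientGroup.ker_mk'] at h
    exact h
  · have hdec : ∀ g : SL(2, K), ∃ x ∈ H, ∃ z ∈ Subgroup.center SL(2, K), g = x * z := by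
      intro g
      obtain ⟨x, hx, hxg⟩ : π g ∈ H.map π := h ▸ Subgroup.mem_top _
      exact ⟨x, hx, x⁻¹ * g, QuotientGroup.eq.mp hxg, by group⟩
    rw [eq_top_iff, ← SL2.commutator_eq_top a.ne_zero ha, commutator_def, Subgroup.commutator_le]
    intro g₁ _ g₂ _
    obtain ⟨x₁, hx₁, z₁, hz₁, rfl⟩ := hdec g₁
    obtain ⟨x₂, hx₂, z₂, hz₂, rfl⟩ := hdec g₂
    rw [Subgroup.mem_center_iff] at hz₁ hz₂
    have : ⁅x₁ * z₁, x₂ * z₂⁆ = x₁ * x₂ * x₁⁻¹ * x₂⁻¹ := by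
      rw [commutatorElement_def, _root_.mul_inv_rev, _root_.mul_inv_rev]
      calc x₁ * z₁ * (x₂ * z₂) * (z₁⁻¹ * x₁⁻¹) * (z₂⁻¹ * x₂⁻¹)
          = x₁ * (z₁ * (x₂ * z₂)) * (z₁⁻¹ * x₁⁻¹) * (z₂⁻¹ * x₂⁻¹) := by group
        _ = x₁ * x₂ * (z₂ * x₁⁻¹) * (z₂⁻¹ * x₂⁻¹) := by rw [← hz₁]; group
        _ = x₁ * x₂ * x₁⁻¹ * x₂⁻¹ := by rw [← hz₂]; group
    rw [this]
    exact H.mul_mem (H.mul_mem (H.mul_mem hx₁ hx₂) (H.inv_mem hx₁)) (H.inv_mem hx₂)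

theorem card_SL2 [Finite K] :
    Nat.card SL(2, K) = Nat.card K * (Nat.card K ^ 2 - 1) := by
  classical
  have := Fintype.ofFinite K
  have hq : 1 < Nat.card K := Finite.one_lt_card
  have hGL := Matrix.card_GL_field (𝔽 := K) 2
  rw [← Subgroup.card_mul_index (Matrix.GeneralLinearGroup.det (n := Fin 2) (R := K)).ker,
    Subgroup.index_ker] at hGL
  have hker : Nat.card (Matrix.GeneralLinearGroup.det (n := Fin 2) (R := K)).ker =
      Nat.card SL(2, K) := by
    refine (Nat.card_congr (Equiv.ofBijective (fun g : SL(2, K) =>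
      (⟨Matrix.SpecialLinearGroup.toGL g, ?_⟩ :
        (Matrix.GeneralLinearGroup.det (n := Fin 2) (R := K)).ker)) ⟨?_, ?_⟩)).symm
    · exact Matrix.SpecialLinearGroup.coeToGL_det g
    · intro g h hgh
      exact Matrix.SpecialLinearGroup.toGL_injective (congrArg Subtype.val hgh)
    · rintro ⟨g, hg⟩
      exact ⟨⟨g, congrArg Units.val hg⟩, Subtype.ext (Units.ext rfl)⟩
  have hrange : Nat.card (Matrix.GeneralLinearGroup.det (n := Fin 2) (R := K)).range =
      Nat.card K - 1 := by
    rw [MonoidHom.range_eq_top.mpr, Subgroup.card_top, Nat.card_units]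
    intro u
    exact Matrix.GeneralLinearGroup.det_surjective u
  rw [hker, hrange, Fin.prod_univ_two] at hGL
  simp only [Fintype.card_eq_nat_card, Fin.val_zero, Fin.val_one, pow_zero, pow_one] at hGL
  apply Nat.eq_of_mul_eq_mul_right (Nat.sub_pos_of_lt hq)
  rw [hGL, mul_comm (Nat.card K), mul_assoc, Nat.mul_sub_one, pow_two]

/-- `q` is the full `p`-part of `|PSL₂(𝔽_q)|`. -/
theorem exists_card_PSL2 [Finite K] :
    ∃ m, Nat.card PSL(2, K) = Nat.card K * m ∧ Nat.Coprime m (Nat.card K) := by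
  have hq : 1 < Nat.card K := Finite.one_lt_card
  have hz : Nat.card (Subgroup.center SL(2, K)) ∣ Nat.card K - 1 := by
    rw [Nat.card_congr (Matrix.SpecialLinearGroup.center_equiv_rootsOfUnity' (0 : Fin 2)).toEquiv,
      ← Nat.card_units]
    exact Subgroup.card_subgroup_dvd_card _
  have hmul := Subgroup.card_mul_index (Subgroup.center SL(2, K))
  rw [card_SL2, Subgroup.index] at hmul
  have hcop1 : Nat.Coprime (Nat.card K - 1) (Nat.card K) := by
    rw [Nat.coprime_self_sub_left hq.le]
    exact Nat.coprime_one_left _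
  have hcop2 : Nat.Coprime (Nat.card K ^ 2 - 1) (Nat.card K) := by
    refine Nat.Coprime.coprime_dvd_right (dvd_pow_self _ two_ne_zero) ?_
    rw [Nat.coprime_self_sub_left (Nat.one_le_pow _ _ (by omega))]
    exact Nat.coprime_one_left _
  obtain ⟨m, hm⟩ : Nat.card K ∣ Nat.card PSL(2, K) :=
    (Nat.Coprime.coprime_dvd_left hz hcop1).symm.dvd_of_dvd_mul_left ⟨_, hmul⟩
  refine ⟨m, hm, Nat.Coprime.coprime_dvd_left ?_ hcop2⟩
  refine ⟨Nat.card (Subgroup.center SL(2, K)), ?_⟩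
  rw [hm] at hmul
  apply Nat.eq_of_mul_eq_mul_left (zero_lt_one.trans hq)
  rw [← hmul]
  ring

end FiniteField

/-! ### Functionals compatible with inversion -/

section Functional

variable {K R : Type*} [Field K] [CommRing R] [Algebra K R]

theorem exists_pow_isIdempotentElem {M : Type*} [CommMonoid M] [Finite M] (x : M) :
    ∃ n, n ≠ 0 ∧ IsIdempotentElem (x ^ n) := by
  obtain ⟨a, b, hne, hab⟩ := Finite.exists_ne_map_eq_of_infinite (fun n : ℕ => x ^ n)
  wlog hlt : a < b generalizing a b
  · exact this b a hne.symm hab.symm (lt_of_le_of_ne (not_lt.mp hlt) hne.symm)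
  obtain ⟨d, rfl⟩ := Nat.exists_eq_add_of_lt hlt
  have hper : ∀ j, x ^ (a + j * (d + 1)) = x ^ a := by
    intro j
    induction j with
    | zero => simp
    | succ j ih =>
      have h : a + (j + 1) * (d + 1) = (a + j * (d + 1)) + (d + 1) := by ring
      rw [h, pow_add, ih, ← pow_add]
      exact hab.symm
  refine ⟨(a + 1) * (d + 1), by positivity, ?_⟩
  obtain ⟨c, hc⟩ : ∃ c, (a + 1) * (d + 1) = a + c := Nat.exists_eq_add_of_le (by nlinarith)
  rw [IsIdempotentElem, ← pow_add]
  calc x ^ ((a + 1) * (d + 1) + (a + 1) * (d + 1))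
      = x ^ (a + (a + 1) * (d + 1)) * x ^ c := by rw [← pow_add]; congr 1; omega
    _ = x ^ ((a + 1) * (d + 1)) := by rw [hper, ← pow_add, hc]

variable {ψ : R →ₗ[K] K} (h1 : ψ 1 = 1) (hinv : ∀ u v : R, u * v = 1 → ψ u * ψ v = 1)

include h1 hinv

/-- The inverse of `1 + x` is `1 - x` up to a multiple of `x ^ 2`, to which induction applies. -/
theorem map_nilpotent_eq_zero {n : ℕ} : ∀ x : R, x ^ n = 0 → ψ x = 0 := by
  induction n using Nat.strong_induction_on with
  | _ n ih =>
  intro x hx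
  rcases Nat.lt_or_ge n 2 with hn | hn
  · have : x = 0 := by
      interval_cases n
      · rw [← one_mul x, ← pow_zero x, hx, zero_mul]
      · simpa using hx
    rw [this, map_zero]
  · obtain ⟨v, hv⟩ := (IsNilpotent.isUnit_one_add ⟨n, hx⟩).exists_right_inv
    have hv' : v = 1 - x + x ^ 2 * v := by linear_combination (1 - x) * hv
    have h0 : ψ (x ^ 2 * v) = 0 := by
      refine ih (n - 1) (by omega) _ ?_
      rw [mul_pow, ← pow_mul, show 2 * (n - 1) = n + (n - 2) by omega, pow_add, hx, zero_mul,
        zero_mul]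
    have h := hinv _ _ hv
    rw [hv', map_add, map_add, map_sub, h0, h1] at h
    have : ψ x ^ 2 = 0 := by linear_combination -h
    exact pow_eq_zero_iff two_ne_zero |>.mp this

theorem map_idempotent (hK : 3 < Nat.card K) {e : R} (he : IsIdempotentElem e) :
    ψ e = 0 ∨ ψ e = 1 := by
  obtain ⟨a, ha0, ha1, -⟩ := exists_ne_of_three_lt_card hK 0 1 0
  have he' : e * e = e := he
  have haa : algebraMap K R a * algebraMap K R a⁻¹ = 1 := by
    rw [← map_mul, mul_inv_cancel₀ ha0, map_one]
  have h := hinv (1 + (a - 1) • e) (1 + (a⁻¹ - 1) • e) (by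
    simp only [Algebra.smul_def, map_sub, map_one]
    linear_combination (algebraMap K R a - 1) * (algebraMap K R a⁻¹ - 1) * he' + e * haa)
  simp only [map_add, map_smul, h1, smul_eq_mul] at h
  have h' : (a - 1) ^ 2 * (ψ e * (ψ e - 1)) = 0 := by
    field_simp at h
    linear_combination -h
  rcases mul_eq_zero.mp ((mul_eq_zero.mp h').resolve_left (pow_ne_zero 2 (sub_ne_zero.mpr ha1)))
    with h | h
  · exact Or.inl h
  · exact Or.inr (sub_eq_zero.mp h)

/-- Compatibility with inversion for the units `(1 - e) + a e x`, for all nonzero constants `a`, is a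
quadratic equation in `a` with leading coefficient `ψ (e * x)`. -/
theorem map_idempotent_mul_unit (hK : 3 < Nat.card K) {e : R} (he : IsIdempotentElem e)
    (h0 : ψ e = 0) {x y : R} (hxy : x * y = 1) : ψ (e * x) = 0 := by
  have he' : e * e = e := he
  refine eq_zero_of_forall_quadratic hK (β := ψ (e * x) * ψ (e * y)) (γ := ψ (e * y)) ?_
  intro a ha
  have haa : algebraMap K R a * algebraMap K R a⁻¹ = 1 := by
    rw [← map_mul, mul_inv_cancel₀ ha, map_one]
  have h := hinv (1 - e + a • (e * x)) (1 - e + a⁻¹ • (e * y)) (by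
    simp only [Algebra.smul_def]
    linear_combination (1 - algebraMap K R a⁻¹ * y - algebraMap K R a * x + x * y) * he' +
      e * hxy + e * e * x * y * haa)
  simp only [map_add, map_sub, map_smul, h1, h0, smul_eq_mul] at h
  field_simp at h
  linear_combination h

omit h1 hinv [Field K] [Algebra K R] in
/-- If the power `e = x ^ n` is idempotent, then `x` is invertible on the factor `e R` and nilpotent
on `(1 - e) R`, so that `x + (1 - e)` is a unit. -/
theorem exists_inv_add_one_sub_pow {n : ℕ} (hn : n ≠ 0) {x : R} (he : IsIdempotentElem (x ^ n)) :
    ∃ y, (x + (1 - x ^ n)) * y = 1 := by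
  have he' : x ^ n * x ^ n = x ^ n := he
  have hnil : IsNilpotent (x * (1 - x ^ n)) := by
    refine ⟨n, ?_⟩
    rw [mul_pow, he.one_sub.pow_eq hn]
    linear_combination -he'
  obtain ⟨z, hz⟩ := hnil.isUnit_one_add.exists_right_inv
  obtain ⟨w, hw⟩ : ∃ w, x * w = x ^ n := ⟨x ^ (n - 1), mul_pow_sub_one hn x⟩
  refine ⟨w * x ^ n + (1 - x ^ n) * z, ?_⟩
  linear_combination x ^ n * hw - w * he' + (1 - x ^ n) * hz + (1 + z - x * z) * he'

/-- In a finite ring, the units span: `x + (1 - x ^ n)` is a unit for a suitable `n`, and the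
idempotent `1 - x ^ n` is a combination of units. -/
theorem map_idempotent_mul [Finite R] (hK : 3 < Nat.card K) {e : R} (he : IsIdempotentElem e)
    (h0 : ψ e = 0) (x : R) : ψ (e * x) = 0 := by
  obtain ⟨n, hn, hf⟩ := exists_pow_isIdempotentElem x
  have hf' : (1 - x ^ n) * (1 - x ^ n) = 1 - x ^ n := hf.one_sub
  obtain ⟨y, hy⟩ := exists_inv_add_one_sub_pow hn hf
  have hunit := map_idempotent_mul_unit h1 hinv hK he h0 hy
  -- the idempotent `1 - x ^ n` is a linear combination of two units
  obtain ⟨a, ha0, ha1, -⟩ := exists_ne_of_three_lt_card hK 0 1 0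
  have haa : algebraMap K R a * algebraMap K R a⁻¹ = 1 := by
    rw [← map_mul, mul_inv_cancel₀ ha0, map_one]
  have hidem := map_idempotent_mul_unit h1 hinv hK he h0
    (x := 1 + (a - 1) • (1 - x ^ n)) (y := 1 + (a⁻¹ - 1) • (1 - x ^ n)) (by
      simp only [Algebra.smul_def, map_sub, map_one]
      linear_combination (algebraMap K R a - 1) * (algebraMap K R a⁻¹ - 1) * hf' +
        (1 - x ^ n) * haa)
  rw [mul_add, mul_one, map_add, h0, zero_add, mul_smul_comm, map_smul, smul_eq_mul] at hidem
  have hidem' := (mul_eq_zero.mp hidem).resolve_left (sub_ne_zero.mpr ha1)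
  rwa [mul_add, map_add, hidem', add_zero] at hunit

/-- With `e` the idempotent power of `x`, the case `ψ e = 1` is impossible because `x + (1 - e)` would
be a unit in the kernel of `ψ`; if `ψ e = 0`, then `ψ` kills `e R`, and `(1 - e) x` is nilpotent. -/
theorem map_mul_eq_zero [Finite R] (hK : 3 < Nat.card K) {x : R} (hx : ψ x = 0) (y : R) :
    ψ (x * y) = 0 := by
  obtain ⟨n, hn, he⟩ := exists_pow_isIdempotentElem x
  have h0 : ψ (x ^ n) = 0 := by
    refine (map_idempotent h1 hinv hK he).resolve_right fun h => ?_
    obtain ⟨v, hv⟩ := exists_inv_add_one_sub_pow hn he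
    have := hinv _ _ hv
    rw [map_add, map_sub, hx, h1, h] at this
    simp at this
  have hsplit : x * y = x ^ n * (x * y) + (1 - x ^ n) * x * y := by ring
  rw [hsplit, map_add, map_idempotent_mul h1 hinv hK he h0, zero_add]
  refine map_nilpotent_eq_zero h1 hinv (n := n) _ ?_
  have he' : x ^ n * x ^ n = x ^ n := he
  rw [mul_pow, mul_pow, he.one_sub.pow_eq hn]
  linear_combination -y ^ n * he'

/-- A functional `ψ` on a finite algebra with `ψ 1 = 1` that is compatible with inversion of units
is multiplicative (a finite analogue of the Gleason–Kahane–Żelazko theorem). -/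
theorem map_mul_of_map_inv [Finite R] (hK : 3 < Nat.card K) (x y : R) :
    ψ (x * y) = ψ x * ψ y := by
  have h := map_mul_eq_zero h1 hinv hK (x := x - ψ x • 1) (by simp [h1]) y
  rw [sub_mul, smul_mul_assoc, one_mul, map_sub, map_smul, smul_eq_mul] at h
  exact sub_eq_zero.mp h

end Functional

theorem finite_quotient {K : Type*} [Field K] [Finite K] {I : Ideal K[X]} (hI : I ≠ ⊥) :
    Finite (K[X] ⧸ I) := by
  obtain ⟨f, hf, hf0⟩ := Submodule.exists_mem_ne_zero_of_ne_bot hI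
  have hmonic : (f * C f.leadingCoeff⁻¹).Monic := Polynomial.monic_mul_leadingCoeff_inv hf0
  have := hmonic.finite_quotient
  have : Finite (K[X] ⧸ Ideal.span {f * C f.leadingCoeff⁻¹}) := Module.finite_of_finite K
  exact Finite.of_surjective _ (Ideal.Quotient.factor_surjective
    ((Ideal.span_singleton_le_iff_mem I).mpr (I.mul_mem_right (C f.leadingCoeff⁻¹) hf)))

/-- A `K`-linear functional on `K[X]` that vanishes on a nonzero ideal `I`, maps `1` to `1` and is
compatible with inversion modulo `I` is the evaluation at a point. -/
theorem eq_eval_of_map_inv {K : Type*} [Field K] [Finite K] (hK : 3 < Nat.card K) {I : Ideal K[X]}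
    (hI : I ≠ ⊥) {φ : K[X] →ₗ[K] K} (h1 : φ 1 = 1) (h0 : ∀ f ∈ I, φ f = 0)
    (hinv : ∀ u v, u * v - 1 ∈ I → φ u * φ v = 1) (f : K[X]) : φ f = f.eval (φ X) := by
  have := finite_quotient hI
  let ψ : (K[X] ⧸ I) →ₗ[K] K := ((I.restrictScalars K).liftQ φ h0).comp
    (Submodule.Quotient.restrictScalarsEquiv K I).symm.toLinearMap
  have hψ : ∀ f, ψ (Ideal.Quotient.mk I f) = φ f := fun f => rfl
  have hmul : ∀ f g, φ (f * g) = φ f * φ g := by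
    intro f g
    rw [← hψ, ← hψ f, ← hψ g, map_mul]
    refine map_mul_of_map_inv (by rw [← map_one (Ideal.Quotient.mk I), hψ, h1]) ?_ hK _ _
    intro u v huv
    obtain ⟨u, rfl⟩ := Ideal.Quotient.mk_surjective u
    obtain ⟨v, rfl⟩ := Ideal.Quotient.mk_surjective v
    rw [hψ, hψ]
    refine hinv u v ?_
    rwa [← Ideal.Quotient.mk_eq_mk_iff_sub_mem, map_mul, map_one]
  have h := Polynomial.algHom_ext (f := AlgHom.ofLinearMap φ h1 hmul)
    (g := Polynomial.aeval (φ X)) (by simp)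
  have := DFunLike.congr_fun h f
  simpa [Polynomial.aeval_def, Polynomial.eval₂_eq_eval_map] using this

/-! ### The quotients `SL₂(K[X]) → PSL₂(K)` -/

section Quotients

variable {K : Type*} [Field K]

/-- The inclusion of `SL₂(K)` into `SL₂(K[X])` as the matrices with constant entries. -/
noncomputable def const : SL(2, K) →* SL(2, K[X]) := Matrix.SpecialLinearGroup.map C

@[simp] theorem const_upper (x : K) : const (upper x) = upper (C x) := map_upper _ _

@[simp] theorem const_weyl : const (weyl : SL(2, K)) = weyl := map_weyl _

theorem const_torus (u : Kˣ) : const (torus u) = torus (Units.map C.toMonoidHom u) := by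
  rw [torus_eq, torus_eq]
  simp

variable {φ : K[X] →ₗ[K] K} (h1 : φ 1 = 1)

theorem linearLift_comp_const : (linearLift φ h1).comp const = MonoidHom.id SL(2, K) :=
  hom_ext_of_upper_of_weyl (fun x => by simp [map_C h1]) (by simp)

@[simp] theorem linearLift_const (g : SL(2, K)) : linearLift φ h1 (const g) = g :=
  DFunLike.congr_fun (linearLift_comp_const h1) g

theorem linearLift_surjective : Function.Surjective (linearLift φ h1) :=
  fun g => ⟨const g, linearLift_const h1 g⟩

/-- A normal subgroup containing the upper unipotent matrices with entries in `ker φ` is the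
preimage under `linearLift φ` of a subgroup of `SL₂(K)`. -/
theorem mem_iff_const_linearLift_mem {N : Subgroup SL(2, K[X])} [N.Normal]
    (hN : ∀ f, φ f = 0 → upper f ∈ N) (g : SL(2, K[X])) :
    g ∈ N ↔ const (linearLift φ h1 g) ∈ N := by
  have hhom : QuotientGroup.mk' N =
      ((QuotientGroup.mk' N).comp const).comp (linearLift φ h1) := by
    refine hom_ext_of_upper_of_weyl (fun f => ?_) (by simp)
    simp only [MonoidHom.comp_apply, linearLift_upper, const_upper, QuotientGroup.mk'_apply]
    rw [eq_comm, QuotientGroup.eq, ← upper_neg, ← upper_add]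
    exact hN _ (by simp [map_C h1])
  rw [← QuotientGroup.eq_one_iff (N := N) g, ← QuotientGroup.eq_one_iff (N := N)]
  have := DFunLike.congr_fun hhom g
  simp only [MonoidHom.comp_apply, QuotientGroup.mk'_apply] at this
  rw [this]

/-- The kernel of the surjection `SL₂(K[X]) → PSL₂(K)` induced by a functional `φ`. -/
noncomputable def projKer (φ : K[X] →ₗ[K] K) (h1 : φ 1 = 1) : Subgroup SL(2, K[X]) :=
  (Subgroup.center SL(2, K)).comap (linearLift φ h1)

instance : (projKer φ h1).Normal := by
  unfold projKer
  infer_instance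

theorem index_projKer : (projKer φ h1).index = Nat.card PSL(2, K) :=
  Subgroup.index_comap_of_surjective _ (linearLift_surjective h1)

theorem upper_mem_projKer {f : K[X]} : upper f ∈ projKer φ h1 ↔ φ f = 0 := by
  rw [projKer, Subgroup.mem_comap, linearLift_upper, upper_mem_center_iff]

/-! ### Normal subgroups of `SL₂(K[X])` -/

/-- The commutator of `torus u` and `upper f`. -/
theorem sub_mul_mem (N : Subgroup SL(2, K[X])) [N.Normal] {u : Kˣ} (hu : torus u ∈ N.comap const)
    (f : K[X]) : upper ((C (u : K) ^ 2 - 1) * f) ∈ N := by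
  have h : torus (Units.map C.toMonoidHom u) ∈ N := by rwa [← const_torus]
  have heq : upper ((C (u : K) ^ 2 - 1) * f) = torus (Units.map C.toMonoidHom u) *
      (upper f * (torus (Units.map C.toMonoidHom u))⁻¹ * (upper f)⁻¹) := by
    rw [← mul_assoc, ← mul_assoc, torus_mul_upper, ← upper_neg, ← upper_add]
    congr 1
    simp
    ring
  rw [heq]
  exact N.mul_mem h (Subgroup.Normal.conj_mem inferInstance _ (N.inv_mem h) _)

/-- A proper normal subgroup meets the constant matrices in scalar matrices only. -/
theorem comap_const_le_center (hK : 3 < Nat.card K) {N : Subgroup SL(2, K[X])} [N.Normal]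
    (hN : N ≠ ⊤) : N.comap const ≤ Subgroup.center SL(2, K) := by
  refine (le_center_or_eq_top hK (N.comap const)).resolve_right fun h => hN ?_
  obtain ⟨u, hu⟩ := exists_unit_sq_ne_one hK
  refine eq_top_of_upper_of_weyl (fun f => ?_) ?_
  · have hmem := sub_mul_mem N (h ▸ Subgroup.mem_top (torus u))
      (C (((u : K) ^ 2 - 1)⁻¹) * f)
    rwa [← C_pow, ← C_1, ← C_sub, ← mul_assoc, C_mul_C_inv (sub_ne_zero.mpr hu), one_mul] at hmem
  · rw [← const_weyl]
    exact Subgroup.mem_comap.mp (h ▸ Subgroup.mem_top (weyl : SL(2, K)))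

theorem card_PSL2_dvd_index (hK : 3 < Nat.card K) {N : Subgroup SL(2, K[X])} [N.Normal]
    (hN : N ≠ ⊤) : Nat.card PSL(2, K) ∣ N.index := by
  refine (Subgroup.index_dvd_of_le (comap_const_le_center hK hN)).trans ?_
  rw [Subgroup.index_comap]
  exact Subgroup.relIndex_dvd_index_of_normal _ _

variable [Finite K]

/-- The polynomials `f` with `upper f ∈ N`, for a normal subgroup `N` (its quasi-level). They form a
`K`-subspace since they are stable under multiplication by squares of constants, hence by
differences of such squares. -/
noncomputable def quasiLevel (N : Subgroup SL(2, K[X])) [N.Normal] : Submodule K K[X] where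
  carrier := {f | upper f ∈ N}
  zero_mem' := by simp [N.one_mem]
  add_mem' {f g} hf hg := by
    simp only [Set.mem_ofPred_eq, upper_add] at *
    exact N.mul_mem hf hg
  smul_mem' k f hf := by
    have hsq : ∀ a : K, upper (C a ^ 2 * f) ∈ N := by
      intro a
      by_cases ha : a = 0
      · simp [ha, N.one_mem]
      · have := (inferInstance : N.Normal).conj_mem _ hf
          (torus (Units.map C.toMonoidHom (Units.mk0 a ha)))
        rwa [torus_mul_upper] at this
    obtain ⟨a, b, hab⟩ := exists_eq_sq_sub_sq k
    have hk : k • f = C a ^ 2 * f + -(C b ^ 2 * f) := by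
      rw [smul_eq_C_mul, hab, C_sub, C_pow, C_pow]
      ring
    simp only [Set.mem_ofPred_eq]
    rw [hk, upper_add, upper_neg]
    exact N.mul_mem (hsq a) (N.inv_mem (hsq b))

theorem mem_quasiLevel {N : Subgroup SL(2, K[X])} [N.Normal] {f : K[X]} :
    f ∈ quasiLevel N ↔ upper f ∈ N := Iff.rfl

theorem card_quotient_quasiLevel_dvd (N : Subgroup SL(2, K[X])) [N.Normal] :
    Nat.card (K[X] ⧸ quasiLevel N) ∣ N.index := by
  let j : Multiplicative K[X] →* SL(2, K[X]) :=
    { toFun := fun f => upper f.toAdd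
      map_one' := upper_zero
      map_mul' := fun f g => upper_add _ _ }
  have h : (N.comap j).index = Nat.card (K[X] ⧸ quasiLevel N) := by
    refine Nat.card_congr (Quotient.congr Multiplicative.toAdd fun f g => ?_)
    rw [Submodule.quotientRel_def, ← neg_mem_iff, neg_sub, sub_eq_neg_add]
    exact QuotientGroup.leftRel_apply
  rw [← h, Subgroup.index_comap]
  exact Subgroup.relIndex_dvd_index_of_normal _ _

/-- For a proper normal subgroup of finite index, either its quasi-level has codimension at least
two and its index is divisible by `q · |PSL₂(K)|`, or its quasi-level is a hyperplane. -/
theorem dvd_index_or_exists_functional (hK : 3 < Nat.card K) {N : Subgroup SL(2, K[X])} [N.Normal]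
    (hN : N ≠ ⊤) (hfin : N.FiniteIndex) :
    Nat.card K * Nat.card PSL(2, K) ∣ N.index ∨
      ∃ φ : K[X] →ₗ[K] K, φ 1 = 1 ∧ ∀ f, φ f = 0 ↔ upper f ∈ N := by
  have hdvd := card_quotient_quasiLevel_dvd N
  have : Finite (K[X] ⧸ quasiLevel N) :=
    Nat.finite_of_card_ne_zero fun h => hfin.index_ne_zero (Nat.eq_zero_of_zero_dvd (h ▸ hdvd))
  have : Module.Finite K (K[X] ⧸ quasiLevel N) := Module.Finite.of_finite
  have hone : (quasiLevel N).mkQ 1 ≠ 0 := by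
    intro h
    have h' : (1 : K[X]) ∈ quasiLevel N := (Submodule.Quotient.mk_eq_zero _).mp h
    have hc : upper (1 : K) ∈ Subgroup.center SL(2, K) := comap_const_le_center hK hN (by
      rw [Subgroup.mem_comap, const_upper, C_1]
      exact h')
    exact one_ne_zero (upper_mem_center_iff.mp hc)
  have hpos : Module.finrank K (K[X] ⧸ quasiLevel N) ≠ 0 := fun h => hone
    ((Module.finrank_zero_iff (R := K)).mp h |>.elim _ _)
  rw [Module.natCard_eq_pow_finrank (K := K)] at hdvd
  by_cases hrank : Module.finrank K (K[X] ⧸ quasiLevel N) = 1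
  · right
    let e : (K[X] ⧸ quasiLevel N) ≃ₗ[K] K :=
      LinearEquiv.ofFinrankEq _ _ (hrank.trans (Module.finrank_self K).symm)
    have he : e ((quasiLevel N).mkQ 1) ≠ 0 := fun h => hone (e.map_eq_zero_iff.mp h)
    refine ⟨(e ((quasiLevel N).mkQ 1))⁻¹ • e.toLinearMap.comp (quasiLevel N).mkQ, ?_, fun f => ?_⟩
    · simpa using inv_mul_cancel₀ he
    · rw [← mem_quasiLevel, ← Submodule.Quotient.mk_eq_zero, ← e.map_eq_zero_iff]
      simp only [LinearMap.smul_apply, LinearMap.comp_apply, smul_eq_mul, mul_eq_zero,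
        inv_eq_zero, he, false_or]
      rfl
  · left
    obtain ⟨m, hm, hcop⟩ := exists_card_PSL2 (K := K)
    have hq2 : Nat.card K ^ 2 ∣ N.index := (pow_dvd_pow _ (by omega)).trans hdvd
    have hmdvd : m ∣ N.index :=
      (Dvd.intro_left _ hm.symm).trans (card_PSL2_dvd_index hK hN)
    rw [hm, ← mul_assoc, ← pow_two]
    exact (hcop.symm.pow_left 2).mul_dvd_of_dvd_of_dvd hq2 hmdvd

theorem one_lt_card_PSL2 (hK : 3 < Nat.card K) : 1 < Nat.card PSL(2, K) := by
  have : IsSimpleGroup PSL(2, K) := Matrix.ProjectiveSpecialLinearGroup.rank_two_simple hK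
  exact Finite.one_lt_card

/-- The normal subgroups of index `|PSL₂(K)|` are the kernels attached to functionals. -/
theorem exists_eq_projKer (hK : 3 < Nat.card K) {N : Subgroup SL(2, K[X])} [N.Normal]
    (hN : N.index = Nat.card PSL(2, K)) :
    ∃ (φ : K[X] →ₗ[K] K) (h1 : φ 1 = 1), N = projKer φ h1 := by
  have hcard := one_lt_card_PSL2 hK
  have htop : N ≠ ⊤ := by
    rintro rfl
    rw [Subgroup.index_top] at hN
    omega
  rcases dvd_index_or_exists_functional hK htop ⟨by omega⟩ with h | ⟨φ, h1, hφ⟩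
  · rw [hN] at h
    have := Nat.le_of_dvd (by omega) h
    nlinarith
  · refine ⟨φ, h1, ?_⟩
    have hcomap : N = (N.comap const).comap (linearLift φ h1) := by
      ext g
      exact mem_iff_const_linearLift_mem h1 (fun f hf => (hφ f).mp hf) g
    have hindex : (N.comap const).index = Nat.card PSL(2, K) := by
      rw [← hN, ← Subgroup.index_comap_of_surjective _ (linearLift_surjective h1), ← hcomap]
    have hle := comap_const_le_center hK htop
    have heq : N.comap const = Subgroup.center SL(2, K) := by
      refine le_antisymm hle (Subgroup.relIndex_eq_one.mp ?_)
      have hmul := Subgroup.relIndex_mul_index hle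
      rw [hindex] at hmul
      exact Nat.eq_of_mul_eq_mul_right (by omega : 0 < Nat.card PSL(2, K))
        (hmul.trans (one_mul _).symm)
    rw [hcomap, heq, projKer]

end Quotients

/-! ### Congruence subgroups of index `|PSL₂(K)|` -/

section Congruence

variable {K : Type*} [Field K]

/-- The product of transvections that equals `!![0, u; -v, 0]` when `u * v = 1`. -/
def weylLift {R : Type*} [CommRing R] (u v : R) : SL(2, R) :=
  upper u * (weyl * upper v * weyl⁻¹) * upper u

theorem coe_weylLift {R : Type*} [CommRing R] (u v : R) :
    (weylLift u v : Matrix (Fin 2) (Fin 2) R) =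
      !![1 - u * v, u + (1 - u * v) * u; -v, 1 - u * v] := by
  simp only [weylLift, Matrix.SpecialLinearGroup.coe_mul, coe_upper, coe_weyl, coe_weyl_inv]
  ext i j
  fin_cases i <;> fin_cases j <;> simp <;> ring

theorem map_weylLift {R S : Type*} [CommRing R] [CommRing S] (f : R →+* S) (u v : R) :
    Matrix.SpecialLinearGroup.map f (weylLift u v) = weylLift (f u) (f v) := by
  simp only [weylLift, map_mul, map_inv, map_upper, map_weyl]

theorem weylLift_mul_upper {R : Type*} [CommRing R] {u v : R} (h : u * v = 1) :
    weylLift u v * upper 1 = weyl * upper (v ^ 2) * weyl⁻¹ * weylLift u v := by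
  apply Subtype.ext
  simp only [Matrix.SpecialLinearGroup.coe_mul, coe_weylLift, coe_upper, coe_weyl, coe_weyl_inv, h]
  ext i j
  fin_cases i <;> fin_cases j <;> simp
  linear_combination -v * h

variable {φ : K[X] →ₗ[K] K} (h1 : φ 1 = 1) {I : Ideal K[X]}
  (hI : principalCongruenceSubgroup K[X] I ≤ projKer φ h1)

theorem upper_mem_principalCongruenceSubgroup {f : K[X]} (hf : f ∈ I) :
    upper f ∈ principalCongruenceSubgroup K[X] I := by
  rw [principalCongruenceSubgroup, MonoidHom.mem_ker, map_upper,
    Ideal.Quotient.eq_zero_iff_mem.mpr hf, upper_zero]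

include hI

/-- If `u` and `v` are inverse modulo `I`, conjugation by `weylLift u v` maps `upper 1` modulo `I` to a
lower unipotent matrix. The image of this relation in `PSL₂(K)` forces the diagonal entry
`1 - φ u * φ v` of `weylLift (φ u) (φ v)` to vanish. -/
theorem map_mul_map_eq_one {u v : K[X]} (huv : u * v - 1 ∈ I) : φ u * φ v = 1 := by
  have huv' : Ideal.Quotient.mk I u * Ideal.Quotient.mk I v = 1 := by
    rw [← map_mul, ← map_one (Ideal.Quotient.mk I)]
    exact Ideal.Quotient.mk_eq_mk_iff_sub_mem _ _ |>.mpr huv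
  have hmem : (weylLift u v * upper 1) * (weyl * upper (v ^ 2) * weyl⁻¹ * weylLift u v)⁻¹ ∈
      principalCongruenceSubgroup K[X] I := by
    rw [principalCongruenceSubgroup, MonoidHom.mem_ker, map_mul, map_inv, mul_inv_eq_one]
    simp only [map_mul, map_inv, map_upper, map_weyl, map_weylLift, map_one, map_pow]
    exact weylLift_mul_upper huv'
  have hcenter := Subgroup.mem_comap.mp (hI hmem)
  obtain ⟨z, hz, hzg⟩ : ∃ z ∈ Subgroup.center SL(2, K), linearLift φ h1 (weylLift u v * upper 1) =
      z * linearLift φ h1 (weyl * upper (v ^ 2) * weyl⁻¹ * weylLift u v) :=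
    ⟨_, hcenter, by rw [map_mul (linearLift φ h1) _ (_)⁻¹, map_inv, inv_mul_cancel_right]⟩
  have hx : linearLift φ h1 (weylLift u v) = weylLift (φ u) (φ v) := by
    simp only [weylLift, map_mul, map_inv, linearLift_upper, linearLift_weyl]
  simp only [map_mul, map_inv, linearLift_upper, linearLift_weyl, hx, h1] at hzg
  obtain ⟨r, -, hr⟩ := Matrix.SpecialLinearGroup.mem_center_iff.mp hz
  have hmat := congrArg Subtype.val hzg
  simp only [Matrix.SpecialLinearGroup.coe_mul, ← hr, coe_weylLift, coe_upper, coe_weyl,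
    coe_weyl_inv] at hmat
  have e00 := congrFun (congrFun hmat 0) 0
  have e01 := congrFun (congrFun hmat 0) 1
  simp at e00 e01
  by_contra hne
  have hp : 1 - φ u * φ v ≠ 0 := fun h => hne (sub_eq_zero.mp h).symm
  have hr1 : r = 1 := by
    refine mul_right_cancel₀ hp ?_
    linear_combination -e00
  rw [hr1] at e01
  exact hp (by linear_combination e01)

/-- A congruence subgroup among the `projKer φ` comes from an evaluation. -/
theorem eq_eval_of_le_projKer [Finite K] (hK : 3 < Nat.card K) (hI0 : I ≠ ⊥) (f : K[X]) :
    φ f = f.eval (φ X) :=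
  eq_eval_of_map_inv hK hI0 h1
    (fun _ hf => (upper_mem_projKer h1).mp (hI (upper_mem_principalCongruenceSubgroup hf)))
    (fun _ _ huv => map_mul_map_eq_one h1 hI huv) f

end Congruence

/-! ### Automorphisms of `SL₂(K[X])` -/

section Automorphism

variable {K : Type*} [Field K]

/-- The automorphism of `SL₂(K[X])` induced by a linear automorphism of `K[X]` fixing `1`. -/
noncomputable def linearAut (e : K[X] ≃ₗ[K] K[X]) (h1 : e 1 = 1) : MulAut SL(2, K[X]) :=
  MonoidHom.toMulEquiv (linearLift (R := K[X]) e.toLinearMap h1)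
    (linearLift (R := K[X]) e.symm.toLinearMap (e.symm_apply_eq.mpr h1.symm))
    (hom_ext_of_upper_of_weyl (by simp) (by simp))
    (hom_ext_of_upper_of_weyl (by simp) (by simp))

theorem linearAut_upper (e : K[X] ≃ₗ[K] K[X]) (h1 : e 1 = 1) (f : K[X]) :
    linearAut e h1 (upper f) = upper (e f) :=
  linearLift_upper (R := K[X]) (φ := e.toLinearMap) h1 f

/-- The linear automorphism `f ↦ f + (φ f - θ f)` of `K[X]`. It fixes `1`, and composing it with `θ`
gives `φ`. -/
noncomputable def shear (φ θ : K[X] →ₗ[K] K) (hφ : φ 1 = 1) (hθ : θ 1 = 1) : K[X] ≃ₗ[K] K[X] :=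
  LinearEquiv.ofLinearMap
    (LinearMap.id + (LinearMap.toSpanSingleton K K[X] 1).comp (φ - θ))
    (LinearMap.id + (LinearMap.toSpanSingleton K K[X] 1).comp (θ - φ))
    (by ext n : 2; simp [hφ, hθ, sub_smul]; abel)
    (by ext n : 2; simp [hφ, hθ, sub_smul]; abel)

theorem shear_apply {φ θ : K[X] →ₗ[K] K} (hφ : φ 1 = 1) (hθ : θ 1 = 1) (f : K[X]) :
    shear φ θ hφ hθ f = f + (φ f - θ f) • 1 := by
  simp [shear]

theorem apply_shear {φ θ : K[X] →ₗ[K] K} (hφ : φ 1 = 1) (hθ : θ 1 = 1) (f : K[X]) :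
    θ (shear φ θ hφ hθ f) = φ f := by
  rw [shear_apply, map_add, map_smul, hθ]
  simp

/-- A normal subgroup containing the upper unipotent matrices with entries divisible by `X` is a
congruence subgroup. -/
theorem isCongruence_of_upper_mem {N : Subgroup SL(2, K[X])} [N.Normal]
    (hN : ∀ f : K[X], f.coeff 0 = 0 → upper f ∈ N) : IsCongruence N := by
  have h1 : lcoeff K 0 1 = 1 := by simp
  refine ⟨Ideal.span {X}, by simp, fun g hg => ?_⟩
  have hlift : linearLift (lcoeff K 0) h1 = Matrix.SpecialLinearGroup.map constantCoeff :=
    hom_ext_of_upper_of_weyl (fun f => by simp [map_upper]) (by simp [map_weyl])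
  have hone : linearLift (lcoeff K 0) h1 g = 1 := by
    rw [hlift]
    rw [mem_principalCongruenceSubgroup] at hg
    ext i j
    have := Polynomial.X_dvd_iff.mp (Ideal.mem_span_singleton.mp (hg i j))
    rw [coeff_sub, sub_eq_zero] at this
    simp only [Matrix.SpecialLinearGroup.map_apply_coe, RingHom.mapMatrix_apply, Matrix.map_apply,
      constantCoeff_apply, this]
    fin_cases i <;> fin_cases j <;> simp
  rw [mem_iff_const_linearLift_mem h1 hN, hone, map_one]
  exact N.one_mem

end Automorphism

/-! ### Normal non-congruence subgroups -/

section NonCongruence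

variable {K : Type*} [Field K]

theorem isCongruence_top : IsCongruence (⊤ : Subgroup SL(2, K[X])) :=
  ⟨⊤, top_ne_bot, le_top⟩

theorem normal_map {N : Subgroup SL(2, K[X])} (hN : N.Normal) (Ψ : MulAut SL(2, K[X])) :
    (N.map Ψ.toMonoidHom).Normal :=
  hN.map _ Ψ.surjective

theorem index_map (N : Subgroup SL(2, K[X])) (Ψ : MulAut SL(2, K[X])) :
    (N.map Ψ.toMonoidHom).index = N.index :=
  Subgroup.index_map_equiv N Ψ

theorem IsGenuineNonCongruence.isNonCongruence {N : Subgroup SL(2, K[X])}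
    (hN : IsGenuineNonCongruence N) : IsNonCongruence N := by
  have h := hN.2 1
  rwa [show (1 : MulAut SL(2, K[X])).toMonoidHom = MonoidHom.id _ from rfl, Subgroup.map_id] at h

theorem IsNonCongruence.ne_top {N : Subgroup SL(2, K[X])} (hN : IsNonCongruence N) : N ≠ ⊤ :=
  fun h => hN.2 (h ▸ isCongruence_top)

/-- The functional `f ↦ f₀ + fᵢ₊₁`. -/
noncomputable def coeffSum (K : Type*) [Field K] (i : ℕ) : K[X] →ₗ[K] K :=
  lcoeff K 0 + lcoeff K (i + 1)

theorem coeffSum_one (i : ℕ) : coeffSum K i 1 = 1 := by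
  simp [coeffSum, coeff_one]

theorem projKer_coeffSum_injective {i j : ℕ}
    (h : projKer (coeffSum K i) (coeffSum_one i) = projKer (coeffSum K j) (coeffSum_one j)) :
    i = j := by
  by_contra hne
  have hi : upper (X ^ (i + 1) - 1 : K[X]) ∈ projKer (coeffSum K i) (coeffSum_one i) := by
    rw [upper_mem_projKer]
    simp [coeffSum, coeff_one, coeff_X_pow]
  rw [h, upper_mem_projKer] at hi
  simp [coeffSum, coeff_one, coeff_X_pow, Ne.symm hne] at hi

instance (n : ℕ) : (⨅ i : Fin n, projKer (coeffSum K i) (coeffSum_one i)).Normal :=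
  Subgroup.normal_iInf_normal fun _ => inferInstance

variable [Finite K]

theorem finiteIndex_projKer {φ : K[X] →ₗ[K] K} (h1 : φ 1 = 1) : (projKer φ h1).FiniteIndex :=
  ⟨by rw [index_projKer]; exact Nat.card_pos.ne'⟩

/-- If the quasi-level of a normal subgroup `N` is a hyperplane, an automorphism of `SL₂(K[X])`
moves that hyperplane to the ideal `(X)`, and `N` to a congruence subgroup. -/
theorem dvd_index_of_isGenuineNonCongruence (hK : 3 < Nat.card K) {N : Subgroup SL(2, K[X])}
    [N.Normal] (hN : IsGenuineNonCongruence N) :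
    Nat.card K * Nat.card PSL(2, K) ∣ N.index := by
  refine (dvd_index_or_exists_functional hK hN.isNonCongruence.ne_top hN.1).resolve_right ?_
  rintro ⟨φ, h1, hφ⟩
  have hθ : lcoeff K 0 1 = 1 := by simp
  have he : shear φ (lcoeff K 0) h1 hθ 1 = 1 := by simp [shear_apply, h1]
  have := normal_map ‹N.Normal› (linearAut _ he)
  refine (hN.2 (linearAut _ he)).2 (isCongruence_of_upper_mem fun f hf => ?_)
  obtain ⟨g, rfl⟩ := (shear φ (lcoeff K 0) h1 hθ).surjective f
  rw [← linearAut_upper _ he]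
  refine Subgroup.mem_map_of_mem _ ((hφ g).mp ?_)
  rw [← apply_shear h1 hθ]
  exact hf

theorem isNonCongruence_projKer_coeffSum (hK : 3 < Nat.card K) :
    IsNonCongruence (projKer (coeffSum K 1) (coeffSum_one 1)) := by
  refine ⟨finiteIndex_projKer _, fun ⟨I, hI0, hI⟩ => ?_⟩
  have h := eq_eval_of_le_projKer (coeffSum_one 1) hI hK hI0 (X ^ 2)
  simp [coeffSum, coeff_X] at h

/-- The intersection of `q + 1` distinct subgroups `projKer φ` is a genuine non-congruence subgroup:
an automorphism permutes the subgroups of this form, and only `q` of them, those coming from the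
evaluations at the elements of `K`, are congruence subgroups. -/
theorem isGenuineNonCongruence_iInf (hK : 3 < Nat.card K) :
    IsGenuineNonCongruence
      (⨅ i : Fin (Nat.card K + 1), projKer (coeffSum K i) (coeffSum_one i)) := by
  have hfin := Subgroup.finiteIndex_iInf
    (fun i : Fin (Nat.card K + 1) => finiteIndex_projKer (coeffSum_one (K := K) i))
  refine ⟨hfin, fun Ψ => ⟨⟨?_⟩, fun ⟨I, hI0, hI⟩ => ?_⟩⟩
  · rw [index_map]
    exact hfin.index_ne_zero
  have hθ : ∀ i : Fin (Nat.card K + 1), ∃ (θ : K[X] →ₗ[K] K) (h1 : θ 1 = 1),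
      (projKer (coeffSum K i) (coeffSum_one i)).map Ψ.toMonoidHom = projKer θ h1 := by
    intro i
    have := normal_map (inferInstance : (projKer (coeffSum K i) (coeffSum_one i)).Normal) Ψ
    exact exists_eq_projKer hK (by rw [index_map, index_projKer])
  choose θ h1 hmap using hθ
  have heval : ∀ i f, θ i f = f.eval (θ i X) := fun i =>
    eq_eval_of_le_projKer (h1 i)
      (hI.trans ((Subgroup.map_mono (iInf_le _ i)).trans (hmap i).le)) hK hI0
  have hinj : Function.Injective fun i => θ i X := by
    intro i j hij
    have hij' : θ i = θ j := LinearMap.ext fun f => by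
      rw [heval i f, heval j f]
      exact congrArg (fun c => f.eval c) hij
    refine Fin.ext (projKer_coeffSum_injective (K := K)
      (Subgroup.map_injective Ψ.injective (?_ : Subgroup.map Ψ.toMonoidHom _ = _)))
    rw [hmap i, hmap j]
    simp only [hij']
  have hcard := Nat.card_le_card_of_injective _ hinj
  rw [Nat.card_fin] at hcard
  omega

end NonCongruence
end DrinfeldSL2

open DrinfeldSL2 in
theorem theorem6p1 (F : Type*) [Field F] [Finite F] (hq : 3 < Nat.card F) :
    (∀ N : Subgroup (Matrix.SpecialLinearGroup (Fin 2) (Polynomial F)),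
      N.Normal → DrinfeldSL2.IsGenuineNonCongruence N →
        Nat.card F * Nat.card (Matrix.ProjectiveSpecialLinearGroup (Fin 2) F) ∣ N.index) ∧
    -- both minima are attained, so `nncs` and `ngncs` are not junk values
    (DrinfeldSL2.normalNonCongruenceIndices (Polynomial F)).Nonempty ∧
    (DrinfeldSL2.normalGenuineNonCongruenceIndices (Polynomial F)).Nonempty ∧
    DrinfeldSL2.nncs (Polynomial F) < DrinfeldSL2.ngncs (Polynomial F) ∧
    DrinfeldSL2.nncs (Polynomial F) =
      Nat.card (Matrix.ProjectiveSpecialLinearGroup (Fin 2) F) := by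
  have hdvd : ∀ N : Subgroup (Matrix.SpecialLinearGroup (Fin 2) (Polynomial F)),
      N.Normal → IsGenuineNonCongruence N →
        Nat.card F * Nat.card (Matrix.ProjectiveSpecialLinearGroup (Fin 2) F) ∣ N.index :=
    fun N _ hN => dvd_index_of_isGenuineNonCongruence hq hN
  have hmem : Nat.card (Matrix.ProjectiveSpecialLinearGroup (Fin 2) F) ∈
      normalNonCongruenceIndices (Polynomial F) :=
    ⟨_, inferInstance, isNonCongruence_projKer_coeffSum hq, index_projKer _⟩
  have hgen : (normalGenuineNonCongruenceIndices (Polynomial F)).Nonempty :=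
    ⟨_, _, inferInstance, isGenuineNonCongruence_iInf hq, rfl⟩
  have hnncs : nncs (Polynomial F) =
      Nat.card (Matrix.ProjectiveSpecialLinearGroup (Fin 2) F) := by
    refine le_antisymm (Nat.sInf_le hmem) (le_csInf ⟨_, hmem⟩ ?_)
    rintro _ ⟨N, hN, hnc, rfl⟩
    exact Nat.le_of_dvd (Nat.pos_of_ne_zero hnc.1.index_ne_zero)
      (card_PSL2_dvd_index hq hnc.ne_top)
  refine ⟨hdvd, ⟨_, hmem⟩, hgen, ?_, hnncs⟩
  obtain ⟨N, hN, hnc, hindex⟩ := Nat.sInf_mem hgen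
  have hle := Nat.le_of_dvd (Nat.pos_of_ne_zero hnc.1.index_ne_zero) (hdvd N hN hnc)
  have hpos := one_lt_card_PSL2 hq
  rw [hnncs, ngncs, ← hindex]
  nlinarith
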